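/- Work on $\mathbb C^3\otimes\mathbb C^3$ with the Hilbert–Schmidt inner product $\langle A,B\rangle=\operatorname{Tr}A^\dagger B$ and norm $\|A\|=\sqrt{\langle A,A\rangle}$. Let $S$ be the set of separable states (convex combinations of products $A\otimes B$ of density matrices); a state is entangled if it is not in $S$, and its HS measure is $D(\rho)=\min_{\sigma\in S}\|\sigma-\rho\|$. An entanglement witness for a state $\rho$ is a Hermitian operator $A$ with $\langle\rho,A\rangle<0$ and $\langle\sigma,A\rangle\ge 0$ for all $\sigma\in S$. For $n,m\in\mathbb Z/3$ let $U_{nm}=\sum_{k=0}^{2}e^{2\pi i kn/3}\,|k\rangle\langle (k+m)\bmod 3|$ be the Weyl operators, let $|\phi_+\rangle=\frac1{\sqrt3}\sum_j|j\rangle\otimes|j\rangle$, let $P_{nk}=(U_{nk}\otimes\mathbb 1)|\phi_+\rangle\langle\phi_+|(U_{nk}^\dagger\otimes\mathbb 1)$ be the Bell projectors, and put $$U=\sum_{(l,m)\ne(0,0)}U_{lm}\otimes U_{-l\,m},\qquad U_1=\sum_{l\in\mathbb Z/3,\ m\neq 0}U_{lm}\otimes U_{-l\,m},\qquad U_2=U_{10}\otimes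 U_{-1\,0}+U_{20}\otimes U_{-2\,0}.$$ For $\alpha,\beta\in\mathbb R$ let $$\rho_{\alpha,\beta}=\frac{1-\alpha-\beta}{9}\,\mathbb 1+\alpha P_{00}+\frac{\beta}{2}(P_{10}+P_{20}).$$ Let Region I be the set of $(\alpha,\beta)$ with $\alpha\le\frac72\beta+1$, $\alpha\le-\beta+1$, $\alpha>\frac{\beta}{8}+\frac14$, and Region II the set of $(\alpha,\beta)$ with $\alpha<\frac54\beta-\frac12$, $\alpha\ge\frac18\beta-\frac18$, $\alpha\le-\beta+1$. For $\tilde\rho\ne\rho$ put $$\tilde C(\tilde\rho,\rho)=\frac{\tilde\rho-\rho-\langle\tilde\rho,\tilde\rho-\rho\rangle\mathbb 1}{\|\tilde\rho-\rho\|}.$$ Then for all real $\alpha,\beta$ one has $\rho_{\alpha,\beta}=\frac19\left(\mathbb 1+(\alpha-\frac\beta2)U_1+(\alpha+\beta)U_2\right)$, and $\rho_{\alpha,\beta}$ is an entangled state if and only if $(\alpha,\beta)$ lies in Region I or in Region II. Moreover: (I) If $(\alpha,\beta)$ is in Region I, then the unique nearest separable state to $\rho_{\alpha,\beta}$ is $$\tilde\rho_\beta=\rho_{\frac14+\frac18\beta,\,\beta}=\frac19\left(\mathbb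 1+\left(\tfrac14-\tfrac38\beta\right)U_1+\left(\tfrac14+\tfrac98\beta\right)U_2\right),$$ the HS measure is $$D(\rho_{\alpha,\beta})=\|\tilde\rho_\beta-\rho_{\alpha,\beta}\|=\frac{2\sqrt2}{3}\left(\alpha-\frac14-\frac18\beta\right),$$ and $\tilde C(\tilde\rho_\beta,\rho_{\alpha,\beta})=\frac1{6\sqrt2}(2\,\mathbb 1-U)$ is an entanglement witness for $\rho_{\alpha,\beta}$, with $\langle\rho_{\alpha,\beta},\tilde C\rangle=-D(\rho_{\alpha,\beta})$. (II) If $(\alpha,\beta)$ is in Region II, then the unique nearest separable state to $\rho_{\alpha,\beta}$ is $\tilde\rho_{\alpha,\beta}=\rho_{\tilde\alpha,\tilde\beta}$ with $\tilde\alpha=\frac1{24}(-2+20\alpha+5\beta)$ and $\tilde\beta=\frac16(2+4\alpha+\beta)$, the HS measure is $$D(\rho_{\alpha,\beta})=\|\tilde\rho_{\alpha,\beta}-\rho_{\alpha,\beta}\|=\frac{1}{6\sqrt2}\left(-4\alpha-2+5\beta\right),$$ and $\tilde C(\tilde\rho_{\alpha,\beta},\rho_{\alpha,\beta})=\frac1{6\sqrt2}(2\,\mathbb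 1+U_1-U_2)$ is an entanglement witness for $\rho_{\alpha,\beta}$, with $\langle\rho_{\alpha,\beta},\tilde C\rangle=-D(\rho_{\alpha,\beta})$. -/

import Mathlib

open scoped Matrix Kronecker ComplexOrder

namespace TwoQudit

noncomputable section

/-- Operators on `ℂ^d ⊗ ℂ^d`, written in the product basis `|i⟩ ⊗ |j⟩`. -/
abbrev Op (d : ℕ) := Matrix (Fin d × Fin d) (Fin d × Fin d) ℂ

/-- A density matrix: positive semidefinite (in particular Hermitian) of trace one. -/
def IsDensity {ι : Type*} [Fintype ι] (ρ : Matrix ι ι ℂ) : Prop :=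
  ρ.PosSemidef ∧ ρ.trace = 1

/-- The set `S` of separable states: convex combinations of products of density matrices. -/
def separableStates (d : ℕ) : Set (Op d) :=
  convexHull ℝ {σ | ∃ A B : Matrix (Fin d) (Fin d) ℂ,
    IsDensity A ∧ IsDensity B ∧ σ = A ⊗ₖ B}

/-- An entangled state: a density matrix that is not separable. -/
def IsEntangled {d : ℕ} (ρ : Op d) : Prop :=
  IsDensity ρ ∧ ρ ∉ separableStates d

/-- The Hilbert–Schmidt inner product `⟨A, B⟩ = Tr (A† B)`. -/
def hsInner {d : ℕ} (A B : Op d) : ℂ := (Aᴴ * B).trace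

/-- The Hilbert–Schmidt norm `‖A‖ = √⟨A, A⟩`. -/
def hsNorm {d : ℕ} (A : Op d) : ℝ := √(hsInner A A).re

/-- The Hilbert–Schmidt measure: the distance to the set of separable states. -/
def hsMeasure {d : ℕ} (ρ : Op d) : ℝ :=
  sInf ((fun σ : Op d => hsNorm (σ - ρ)) '' separableStates d)

/-- `ρ₀` is the nearest separable state to `ρ`: it is separable, and every other separable state
is strictly farther away from `ρ`. -/
def IsNearestSeparable {d : ℕ} (ρ ρ₀ : Op d) : Prop :=
  ρ₀ ∈ separableStates d ∧
    ∀ σ ∈ separableStates d, σ ≠ ρ₀ → hsNorm (ρ₀ - ρ) < hsNorm (σ - ρ)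

/-- `A` is an entanglement witness that detects `ρ`.  (For Hermitian `A` and states `σ` the
numbers `⟨σ, A⟩` are real.) -/
def IsWitness {d : ℕ} (A ρ : Op d) : Prop :=
  A.IsHermitian ∧ (hsInner ρ A).re < 0 ∧ ∀ σ ∈ separableStates d, 0 ≤ (hsInner σ A).re

/-- The operator `(ρ₀ - ρ - ⟨ρ₀, ρ₀ - ρ⟩ 𝟙) / ‖ρ₀ - ρ‖`. -/
def witnessOp {d : ℕ} (ρ₀ ρ : Op d) : Op d :=
  ((hsNorm (ρ₀ - ρ) : ℂ))⁻¹ • (ρ₀ - ρ - hsInner ρ₀ (ρ₀ - ρ) • (1 : Op d))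

/-- The Weyl operator `U_{nm} = ∑ₖ e^{2πi kn/d} |k⟩⟨(k+m) mod d|`; the indices are residues
modulo `d`, and `+`, `-` on `Fin d` are taken modulo `d`. -/
def weyl {d : ℕ} (n m : Fin d) : Matrix (Fin d) (Fin d) ℂ :=
  Matrix.of fun k l =>
    if l = k + m then Complex.exp (2 * Real.pi * Complex.I / d * (k.val * n.val)) else 0

/-- The maximally entangled vector `|φ₊⟩ = d^{-1/2} ∑ⱼ |j⟩ ⊗ |j⟩`. -/
def phiPlus (d : ℕ) : Fin d × Fin d → ℂ :=
  fun p => if p.1 = p.2 then ((√(d : ℝ) : ℝ) : ℂ)⁻¹ else 0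

/-- The Bell projector `P_{nk} = (U_{nk} ⊗ 𝟙) |φ₊⟩⟨φ₊| (U_{nk}† ⊗ 𝟙)`. -/
def bell {d : ℕ} (n k : Fin d) : Op d :=
  (weyl n k ⊗ₖ (1 : Matrix (Fin d) (Fin d) ℂ)) *
    Matrix.vecMulVec (phiPlus d) (star (phiPlus d)) *
    ((weyl n k)ᴴ ⊗ₖ (1 : Matrix (Fin d) (Fin d) ℂ))

/-- `U_{lm} ⊗ U_{-l m}`. -/
def weylPair (l m : Fin 3) : Op 3 := weyl l m ⊗ₖ weyl (-l) m

/-- `U = ∑_{(l,m) ≠ (0,0)} U_{lm} ⊗ U_{-l m}`. -/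
def opU : Op 3 :=
  ∑ p ∈ (Finset.univ : Finset (Fin 3 × Fin 3)).erase (0, 0), weylPair p.1 p.2

/-- The part `U₁` of `U`: the terms with `m ≠ 0`. -/
def opU₁ : Op 3 :=
  weylPair 0 1 + weylPair 0 2 + weylPair 1 1 + weylPair 1 2 + weylPair 2 1 + weylPair 2 2

/-- The part `U₂` of `U`: the terms with `m = 0`. -/
def opU₂ : Op 3 := weylPair 1 0 + weylPair 2 0

/-- The two-parameter two-qutrit operators
`ρ_{α,β} = (1-α-β)/9 𝟙 + α P₀₀ + (β/2) (P₁₀ + P₂₀)`. -/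
def rho (α β : ℝ) : Op 3 :=
  ((1 - α - β) / 9) • (1 : Op 3) + α • bell 0 0 + (β / 2) • (bell 1 0 + bell 2 0)

/-- The operators `(1/9) (𝟙 + a U₁ + b U₂)`. -/
def bloch (a b : ℝ) : Op 3 :=
  (1 / 9 : ℝ) • ((1 : Op 3) + a • opU₁ + b • opU₂)

/-- Region I of the parameter plane. -/
def RegionI (α β : ℝ) : Prop :=
  α ≤ 7 / 2 * β + 1 ∧ α ≤ -β + 1 ∧ β / 8 + 1 / 4 < α

/-- Region II of the parameter plane. -/
def RegionII (α β : ℝ) : Prop :=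
  α < 5 / 4 * β - 1 / 2 ∧ 1 / 8 * β - 1 / 8 ≤ α ∧ α ≤ -β + 1

end

end TwoQudit

namespace TwoQudit

/-! Every operator in the theorem lies in the span of the identity, D = ∑ |jj⟩⟨jj| and J = ∑
|jj⟩⟨kk|: U₁ = 3J - 3D, U₂ = 3D - 𝟙, P₀₀ = J/3, P₁₀ + P₂₀ = D - J/3. Positivity, traces and inner
products thus become arithmetic with three real coefficients, and the states ρ_{α,β} fill a triangle
in the parameter plane.

In that triangle the separable states form a trapezoid. Its four corners are explicit averages of
product states, which gives one inclusion (`rho_mem_separableStates`). Its top and right edges are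
cut out by the witnesses 𝟙 - J and 𝟙 - 2D + J, which are nonnegative on all separable states
(`re_hsInner_lincomb_nonneg`) by the 2×2 minors of a product A ⊗ B. The triangle minus the trapezoid
is Region I together with Region II.

In each region the nearest separable state is the orthogonal projection onto the adjacent edge. The
foot stays on the edge, and `witnessOp` there is √2/4 times the witness of that edge. Nonnegativity
of `witnessOp` on S says that σ - ρ₀ and ρ₀ - ρ never have negative inner product, so ρ₀ is the
unique minimiser over all of S, not only within the plane
(`isNearestSeparable_of_witnessOp_nonneg`). -/

/-! ### The commutative algebra spanned by `1`, `diagOp` and `onesOp` -/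

/-- The projector `∑ⱼ |jj⟩⟨jj|`. -/
def diagOp : Op 3 := Matrix.of fun p q => if p.1 = p.2 ∧ p = q then 1 else 0

/-- The operator `∑ⱼₖ |jj⟩⟨kk|`. -/
def onesOp : Op 3 := Matrix.of fun p q => if p.1 = p.2 ∧ q.1 = q.2 then 1 else 0

/-- The real combination `x 𝟙 + y ∑ⱼ |jj⟩⟨jj| + z ∑ⱼₖ |jj⟩⟨kk|`. -/
noncomputable def lincomb (x y z : ℝ) : Op 3 := x • (1 : Op 3) + y • diagOp + z • onesOp

theorem lincomb_add (x y z x' y' z' : ℝ) :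
    lincomb x y z + lincomb x' y' z' = lincomb (x + x') (y + y') (z + z') := by
  simp only [lincomb]; module

theorem lincomb_sub (x y z x' y' z' : ℝ) :
    lincomb x y z - lincomb x' y' z' = lincomb (x - x') (y - y') (z - z') := by
  simp only [lincomb]; module

theorem smul_lincomb (r x y z : ℝ) :
    r • lincomb x y z = lincomb (r * x) (r * y) (r * z) := by
  simp only [lincomb]; module

theorem one_eq_lincomb : (1 : Op 3) = lincomb 1 0 0 := by
  simp only [lincomb]; module

theorem lincomb_apply (x y z : ℝ) (i j k l : Fin 3) :
    lincomb x y z (i, j) (k, l) =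
      (if i = k ∧ j = l then (x : ℂ) else 0) + (if i = j ∧ i = k ∧ j = l then (y : ℂ) else 0) +
        (if i = j ∧ k = l then (z : ℂ) else 0) := by
  simp [lincomb, diagOp, onesOp, Matrix.one_apply]

theorem lincomb_isHermitian (x y z : ℝ) : (lincomb x y z).IsHermitian := by
  ext ⟨i, j⟩ ⟨k, l⟩
  rw [Matrix.conjTranspose_apply, lincomb_apply, lincomb_apply]
  simp only [star_add, apply_ite (star : ℂ → ℂ), star_zero, Complex.star_def, Complex.conj_ofReal]
  congr 2
  · grind
  · grind
  · grind

/-! ### Weyl operators in dimension three -/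

/-- The primitive cube root of unity `e^{2πi/3}`. -/
noncomputable def cubeRoot : ℂ := Complex.exp (2 * Real.pi * Complex.I / 3)

theorem cubeRoot_isPrimitiveRoot : IsPrimitiveRoot cubeRoot 3 := by
  simpa [cubeRoot] using Complex.isPrimitiveRoot_exp 3 (by norm_num)

theorem cubeRoot_pow_three : cubeRoot ^ 3 = 1 := cubeRoot_isPrimitiveRoot.pow_eq_one

theorem cubeRoot_sq : cubeRoot ^ 2 = -1 - cubeRoot := by
  have h := cubeRoot_isPrimitiveRoot.geom_sum_eq_zero (by norm_num)
  simp only [Finset.sum_range_succ, Finset.sum_range_zero] at h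
  linear_combination h

theorem star_cubeRoot : star cubeRoot = cubeRoot ^ 2 := by
  have h0 : cubeRoot ≠ 0 := Complex.exp_ne_zero _
  have h1 : star cubeRoot * cubeRoot = 1 := by
    have : ‖cubeRoot‖ = 1 :=
      Complex.norm_eq_one_of_pow_eq_one cubeRoot_pow_three (by norm_num)
    rw [Complex.star_def, mul_comm, Complex.mul_conj, Complex.normSq_eq_norm_sq, this]
    norm_num
  apply mul_right_cancel₀ h0
  rw [h1, ← pow_succ, cubeRoot_pow_three]

theorem weyl_apply (n m k l : Fin 3) :
    weyl n m k l = if l = k + m then cubeRoot ^ (k.val * n.val) else 0 := by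
  simp only [weyl, Matrix.of_apply, cubeRoot, ← Complex.exp_nat_mul]
  congr 2
  push_cast
  ring

theorem sum_cubeRoot_pow (i j : Fin 3) :
    ∑ n : Fin 3, cubeRoot ^ (i.val * n.val) * cubeRoot ^ (j.val * (-n).val) =
      if i = j then 3 else 0 := by
  have h2 := cubeRoot_sq
  have h3 := cubeRoot_pow_three
  have h4 : cubeRoot ^ 4 = cubeRoot := by rw [pow_succ, h3, one_mul]
  have h6 : cubeRoot ^ 6 = 1 := by rw [pow_mul cubeRoot 3 2, h3, one_pow]
  have e1 : (-1 : Fin 3) = 2 := rfl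
  have e2 : (-2 : Fin 3) = 1 := rfl
  fin_cases i <;> fin_cases j <;>
    simp [Fin.sum_univ_three, e1, e2, ← pow_add, h2, h3, h4] <;>
    grind

/-- The opposite index -n in the second factor turns the phases into ω^{n(i-j)}, so summing over n
annihilates every entry with i ≠ j. What remains is 3 ∑ᵢ |ii⟩⟨i+m, i+m|: m = 0 gives 3D, and m = 1,
2 together give 3(J - D). -/
theorem sum_weylPair_apply (m i j k l : Fin 3) :
    ∑ n : Fin 3, weylPair n m (i, j) (k, l) = if k = i + m ∧ l = j + m ∧ i = j then 3 else 0 := by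
  simp only [weylPair, Matrix.kroneckerMap_apply, weyl_apply]
  by_cases hk : k = i + m
  · by_cases hl : l = j + m
    · simp only [hk, hl, if_true, true_and, sum_cubeRoot_pow]
    · simp [hl]
  · simp [hk]

theorem opU₁_eq : opU₁ = lincomb 0 (-3) 3 := by
  have h : opU₁ = (∑ n : Fin 3, weylPair n 1) + ∑ n : Fin 3, weylPair n 2 := by
    simp only [opU₁, Fin.sum_univ_three]; abel
  ext ⟨i, j⟩ ⟨k, l⟩
  rw [h, Matrix.add_apply, Matrix.sum_apply, Matrix.sum_apply, sum_weylPair_apply,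
    sum_weylPair_apply, lincomb_apply]
  by_cases hij : i = j
  · subst hij
    by_cases hkl : k = l
    · subst hkl
      fin_cases i <;> fin_cases k <;> simp
    · have h1 (m : Fin 3) : ¬ (k = i + m ∧ l = i + m) := fun h => hkl (h.1.trans h.2.symm)
      have h2 : ¬ (i = k ∧ i = l) := fun h => hkl (h.1.symm.trans h.2)
      simp [h1, h2, hkl]
  · simp [hij]

theorem weylPair_zero_zero : weylPair 0 0 = 1 := by
  have : weyl (0 : Fin 3) 0 = 1 := by
    ext k l
    simp [weyl_apply, Matrix.one_apply, eq_comm]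
  rw [weylPair, neg_zero, this, Matrix.one_kronecker_one]

theorem opU₂_eq : opU₂ = lincomb (-1) 3 0 := by
  have h : opU₂ = (∑ n : Fin 3, weylPair n 0) - 1 := by
    simp only [opU₂, Fin.sum_univ_three, weylPair_zero_zero]; abel
  ext ⟨i, j⟩ ⟨k, l⟩
  rw [h, Matrix.sub_apply, Matrix.sum_apply, sum_weylPair_apply, lincomb_apply, Matrix.one_apply]
  by_cases hij : i = j <;> by_cases hk : i = k <;> by_cases hl : j = l <;>
    simp_all [eq_comm]
  norm_num

theorem opU_eq : opU = lincomb (-1) 0 3 := by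
  have h : opU = opU₁ + opU₂ := by
    have h1 := Finset.add_sum_erase (Finset.univ : Finset (Fin 3 × Fin 3))
      (fun p => weylPair p.1 p.2) (Finset.mem_univ (0, 0))
    rw [Fintype.sum_prod_type] at h1
    simp only [Fin.sum_univ_three] at h1
    rw [opU, ← add_right_inj (weylPair 0 0), h1, opU₁, opU₂]
    abel
  rw [h, opU₁_eq, opU₂_eq, lincomb_add]
  norm_num

/-! ### The Bell projectors and the two-parameter operators -/

/-- `weyl n 0` is diagonal, so it only puts phases ω^{jn} on the terms |jj⟩ of φ₊. The exponent
doubles in the second factor because conjugation squares a cube root of unity. -/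
theorem bell_zero_right_apply (n i j k l : Fin 3) :
    bell n 0 (i, j) (k, l) =
      if i = j ∧ k = l then cubeRoot ^ (i.val * n.val) * cubeRoot ^ (2 * (k.val * n.val)) / 3
        else 0 := by
  have hw : weyl n 0 = Matrix.diagonal fun k : Fin 3 => cubeRoot ^ (k.val * n.val) := by
    ext k l
    simp [weyl_apply, Matrix.diagonal_apply, eq_comm]
  have hs : ((√(3 : ℝ) : ℝ) : ℂ)⁻¹ * ((√(3 : ℝ) : ℝ) : ℂ)⁻¹ = 1 / 3 := by
    rw [← mul_inv, ← Complex.ofReal_mul, Real.mul_self_sqrt (by norm_num)]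
    norm_num
  rw [bell, hw, Matrix.diagonal_conjTranspose, ← Matrix.diagonal_one,
    Matrix.diagonal_kronecker_diagonal, Matrix.diagonal_kronecker_diagonal,
    Matrix.mul_diagonal, Matrix.diagonal_mul, Matrix.vecMulVec_apply]
  by_cases hij : i = j <;> by_cases hkl : k = l <;> simp [phiPlus, hij, hkl]
  rw [← Complex.star_def, star_cubeRoot, ← pow_mul]
  linear_combination (cubeRoot ^ (j.val * n.val) * cubeRoot ^ (2 * (l.val * n.val))) * hs

theorem bell_zero_zero_eq : bell (0 : Fin 3) 0 = lincomb 0 0 (1 / 3) := by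
  ext ⟨i, j⟩ ⟨k, l⟩
  rw [bell_zero_right_apply, lincomb_apply]
  simp

/-- P₀₀, P₁₀, P₂₀ resolve the projector D onto the span of the |jj⟩, so these two sum to D - P₀₀. -/
theorem bell_one_add_bell_two_eq :
    bell (1 : Fin 3) 0 + bell (2 : Fin 3) 0 = lincomb 0 1 (-1 / 3) := by
  ext ⟨i, j⟩ ⟨k, l⟩
  rw [Matrix.add_apply, bell_zero_right_apply, bell_zero_right_apply, lincomb_apply]
  by_cases hij : i = j
  · by_cases hkl : k = l
    · subst hij hkl
      have h2 := cubeRoot_sq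
      have h3 := cubeRoot_pow_three
      fin_cases i <;> fin_cases k <;> simp <;> grind
    · simp [hij, hkl]
      grind
  · simp [hij]

theorem rho_eq (α β : ℝ) :
    rho α β = lincomb ((1 - α - β) / 9) (β / 2) ((α - β / 2) / 3) := by
  rw [rho, bell_one_add_bell_two_eq, bell_zero_zero_eq, one_eq_lincomb]
  simp only [smul_lincomb, lincomb_add]
  congr 1 <;> ring

theorem bloch_eq (a b : ℝ) :
    bloch a b = lincomb ((1 - b) / 9) ((b - a) / 3) (a / 3) := by
  rw [bloch, opU₁_eq, opU₂_eq, one_eq_lincomb]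
  simp only [smul_lincomb, lincomb_add]
  congr 1 <;> ring

/-! ### The Hilbert–Schmidt inner product -/

section HilbertSchmidt

variable {d : ℕ}

theorem hsInner_add_left (A B C : Op d) : hsInner (A + B) C = hsInner A C + hsInner B C := by
  simp [hsInner, Matrix.add_mul]

theorem hsInner_add_right (A B C : Op d) : hsInner A (B + C) = hsInner A B + hsInner A C := by
  simp [hsInner, Matrix.mul_add]

theorem hsInner_sub_left (A B C : Op d) : hsInner (A - B) C = hsInner A C - hsInner B C := by
  simp [hsInner, Matrix.sub_mul]

theorem hsInner_sub_right (A B C : Op d) : hsInner A (B - C) = hsInner A B - hsInner A C := by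
  simp [hsInner, Matrix.mul_sub]

theorem hsInner_smul_right (A B : Op d) (c : ℂ) : hsInner A (c • B) = c * hsInner A B := by
  simp [hsInner]

theorem hsInner_real_smul_right (A B : Op d) (r : ℝ) : hsInner A (r • B) = r * hsInner A B := by
  simp [hsInner]

theorem hsInner_real_smul_left (A B : Op d) (r : ℝ) : hsInner (r • A) B = r * hsInner A B := by
  simp [hsInner]

theorem hsInner_one_right (A : Op d) : hsInner A 1 = star A.trace := by
  simp [hsInner, Matrix.trace_conjTranspose]

theorem star_hsInner (A B : Op d) : star (hsInner A B) = hsInner B A := by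
  rw [hsInner, ← Matrix.trace_conjTranspose, Matrix.conjTranspose_mul,
    Matrix.conjTranspose_conjTranspose, hsInner]

theorem hsInner_eq_sum (A B : Op d) : hsInner A B = ∑ p, ∑ q, star (A p q) * B p q := by
  rw [hsInner, Matrix.trace, Finset.sum_comm]
  simp [Matrix.mul_apply]

theorem re_hsInner_self (A : Op d) : (hsInner A A).re = ∑ p, ∑ q, Complex.normSq (A p q) := by
  simp only [hsInner_eq_sum, Complex.re_sum]
  refine Finset.sum_congr rfl fun p _ => Finset.sum_congr rfl fun q _ => ?_
  simp [Complex.normSq_apply]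

theorem re_hsInner_self_nonneg (A : Op d) : 0 ≤ (hsInner A A).re := by
  rw [re_hsInner_self]
  exact Finset.sum_nonneg fun p _ => Finset.sum_nonneg fun q _ => Complex.normSq_nonneg _

theorem re_hsInner_self_pos {A : Op d} (hA : A ≠ 0) : 0 < (hsInner A A).re := by
  refine lt_of_le_of_ne (re_hsInner_self_nonneg A) fun h => hA ?_
  rw [re_hsInner_self] at h
  ext p q
  have hp := (Finset.sum_eq_zero_iff_of_nonneg fun p _ =>
    Finset.sum_nonneg fun q _ => Complex.normSq_nonneg (A p q)).1 h.symm p (Finset.mem_univ p)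
  have hq := (Finset.sum_eq_zero_iff_of_nonneg fun q _ =>
    Complex.normSq_nonneg (A p q)).1 hp q (Finset.mem_univ q)
  exact Complex.normSq_eq_zero.1 hq

theorem re_hsInner_add_self (A B : Op d) :
    (hsInner (A + B) (A + B)).re =
      (hsInner A A).re + 2 * (hsInner A B).re + (hsInner B B).re := by
  have h : (hsInner B A).re = (hsInner A B).re := by
    rw [← star_hsInner A B, Complex.star_def, Complex.conj_re]
  simp only [hsInner_add_left, hsInner_add_right, Complex.add_re, h]
  ring

/-! ### Separable states -/

/-- A set that contains all products of density matrices and is convex contains `S`. -/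
theorem separableStates_subset {T : Set (Op d)} (hT : Convex ℝ T)
    (h : ∀ A B : Matrix (Fin d) (Fin d) ℂ, IsDensity A → IsDensity B → A ⊗ₖ B ∈ T) :
    separableStates d ⊆ T := by
  refine convexHull_min ?_ hT
  rintro _ ⟨A, B, hA, hB, rfl⟩
  exact h A B hA hB

theorem kronecker_mem_separableStates {A B : Matrix (Fin d) (Fin d) ℂ} (hA : IsDensity A)
    (hB : IsDensity B) : A ⊗ₖ B ∈ separableStates d :=
  subset_convexHull ℝ _ ⟨A, B, hA, hB, rfl⟩

theorem convex_separableStates : Convex ℝ (separableStates d) := convex_convexHull ℝ _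

theorem trace_of_mem_separableStates {σ : Op d} (hσ : σ ∈ separableStates d) :
    σ.trace = 1 := by
  have hT : Convex ℝ {σ : Op d | σ.trace = 1} := by
    intro x hx y hy a b _ _ hab
    simp only [Set.mem_ofPred_eq] at hx hy ⊢
    rw [Matrix.trace_add, Matrix.trace_smul, Matrix.trace_smul, hx, hy, ← add_smul, hab, one_smul]
  refine separableStates_subset hT (fun A B hA hB => ?_) hσ
  simp [Matrix.trace_kronecker, hA.2, hB.2]

theorem re_hsInner_nonneg_of_mem_separableStates {W : Op d}
    (h : ∀ A B : Matrix (Fin d) (Fin d) ℂ, IsDensity A → IsDensity B →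
      0 ≤ (hsInner (A ⊗ₖ B) W).re) {σ : Op d} (hσ : σ ∈ separableStates d) :
    0 ≤ (hsInner σ W).re := by
  have hT : Convex ℝ {σ : Op d | 0 ≤ (hsInner σ W).re} := by
    intro x hx y hy a b ha hb _
    simp only [Set.mem_ofPred_eq] at hx hy ⊢
    rw [hsInner_add_left, hsInner_real_smul_left, hsInner_real_smul_left, Complex.add_re,
      Complex.re_ofReal_mul, Complex.re_ofReal_mul]
    positivity
  exact separableStates_subset hT h hσ

/-- A separable state `ρ₀` whose operator `witnessOp ρ₀ ρ` is nonnegative on separable states is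
the nearest separable state to `ρ`. -/
theorem isNearestSeparable_of_witnessOp_nonneg {ρ ρ₀ : Op d} (h₀ : ρ₀ ∈ separableStates d)
    (hN : 0 < hsNorm (ρ₀ - ρ))
    (hW : ∀ σ ∈ separableStates d, 0 ≤ (hsInner σ (witnessOp ρ₀ ρ)).re) :
    IsNearestSeparable ρ ρ₀ := by
  refine ⟨h₀, fun σ hσ hne => ?_⟩
  -- Since τ has trace one, the multiple of 𝟙 in `witnessOp` contributes a constant, chosen so that
  -- the functional vanishes at ρ₀.
  have key : ∀ τ ∈ separableStates d, (hsNorm (ρ₀ - ρ) : ℂ) * hsInner τ (witnessOp ρ₀ ρ) =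
      hsInner τ (ρ₀ - ρ) - hsInner ρ₀ (ρ₀ - ρ) := by
    intro τ hτ
    have hN' : (hsNorm (ρ₀ - ρ) : ℂ) ≠ 0 := by exact_mod_cast hN.ne'
    rw [witnessOp, hsInner_smul_right, mul_inv_cancel_left₀ hN', hsInner_sub_right,
      hsInner_smul_right, hsInner_one_right, trace_of_mem_separableStates hτ, star_one, mul_one]
  -- The variational inequality of a projection: in ‖σ - ρ‖² = ‖(σ - ρ₀) + (ρ₀ - ρ)‖² the cross term
  -- is nonnegative, and ‖σ - ρ₀‖² > 0 makes the comparison strict.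
  have h1 : 0 ≤ (hsInner (σ - ρ₀) (ρ₀ - ρ)).re := by
    rw [hsInner_sub_left, ← key σ hσ, Complex.re_ofReal_mul]
    exact mul_nonneg hN.le (hW σ hσ)
  have h2 : 0 < (hsInner (σ - ρ₀) (σ - ρ₀)).re := re_hsInner_self_pos (sub_ne_zero.2 hne)
  have h3 := re_hsInner_add_self (σ - ρ₀) (ρ₀ - ρ)
  rw [sub_add_sub_cancel] at h3
  exact Real.sqrt_lt_sqrt (re_hsInner_self_nonneg _) (by linarith)

theorem IsNearestSeparable.hsMeasure_eq {ρ ρ₀ : Op d} (h : IsNearestSeparable ρ ρ₀) :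
    hsMeasure ρ = hsNorm (ρ₀ - ρ) := by
  refine IsLeast.csInf_eq ⟨⟨ρ₀, h.1, rfl⟩, ?_⟩
  rintro _ ⟨σ, hσ, rfl⟩
  by_cases hne : σ = ρ₀
  · rw [hne]
  · exact (h.2 σ hσ hne).le

end HilbertSchmidt

/-! ### Inner products with the operators `lincomb x y z` -/

theorem hsInner_lincomb_right (A : Op 3) (x y z : ℝ) :
    hsInner A (lincomb x y z) = x * star A.trace + y * ∑ i, star (A (i, i) (i, i)) +
      z * ∑ i, ∑ k, star (A (i, i) (k, k)) := by
  have hD : hsInner A diagOp = ∑ i, star (A (i, i) (i, i)) := by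
    rw [hsInner_eq_sum]
    simp [diagOp, Fintype.sum_prod_type, Fin.sum_univ_three]
  have hJ : hsInner A onesOp = ∑ i, ∑ k, star (A (i, i) (k, k)) := by
    rw [hsInner_eq_sum]
    simp [onesOp, Fintype.sum_prod_type, Fin.sum_univ_three]
  rw [lincomb, hsInner_add_right, hsInner_add_right, hsInner_real_smul_right,
    hsInner_real_smul_right, hsInner_real_smul_right, hsInner_one_right, hD, hJ]

theorem trace_lincomb (x y z : ℝ) : (lincomb x y z).trace = ((9 * x + 3 * y + 3 * z : ℝ) : ℂ) := by
  simp [Matrix.trace, Fintype.sum_prod_type, Fin.sum_univ_three, lincomb_apply]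
  ring

theorem hsInner_lincomb_lincomb (x y z x' y' z' : ℝ) :
    hsInner (lincomb x y z) (lincomb x' y' z') =
      ((x' * (9 * x + 3 * y + 3 * z) + y' * (3 * x + 3 * y + 3 * z) +
        z' * (3 * x + 3 * y + 9 * z) : ℝ) : ℂ) := by
  rw [hsInner_lincomb_right, trace_lincomb]
  simp [Fin.sum_univ_three, lincomb_apply, -mul_eq_mul_left_iff, -add_right_inj]
  ring

/-! ### Positivity -/

/-- The off-diagonal entries of two positive semidefinite matrices are jointly dominated by
their diagonal entries. -/
theorem norm_mul_norm_le_of_posSemidef {ι : Type*} [Fintype ι] {A B : Matrix ι ι ℂ}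
    (hA : A.PosSemidef) (hB : B.PosSemidef) (i j : ι) :
    2 * (‖A i j‖ * ‖B i j‖) ≤ (A i i).re * (B j j).re + (A j j).re * (B i i).re := by
  classical
  have minor : ∀ {M : Matrix ι ι ℂ}, M.PosSemidef →
      ‖M i j‖ ^ 2 ≤ (M i i).re * (M j j).re ∧ 0 ≤ (M i i).re ∧ 0 ≤ (M j j).re := by
    intro M hM
    have hdiag : ∀ k, 0 ≤ (M k k).re ∧ (M k k).im = 0 := fun k => by
      have h := hM.diag_nonneg (i := k)
      rw [Complex.le_def] at h
      exact ⟨h.1, h.2.symm⟩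
    refine ⟨?_, (hdiag i).1, (hdiag j).1⟩
    have hdet := (hM.submatrix ![i, j]).det_nonneg
    have hji : M j i = star (M i j) := (hM.isHermitian.apply j i).symm
    rw [Matrix.det_fin_two] at hdet
    simp only [Matrix.submatrix_apply, Matrix.cons_val_zero, Matrix.cons_val_one, hji,
      Complex.star_def, Complex.mul_conj, Complex.normSq_eq_norm_sq] at hdet
    have := (Complex.le_def.1 hdet).1
    rw [Complex.sub_re, Complex.mul_re, (hdiag i).2, Complex.ofReal_re] at this
    simp at this
    exact_mod_cast this
  obtain ⟨hA1, hA2, hA3⟩ := minor hA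
  obtain ⟨hB1, hB2, hB3⟩ := minor hB
  -- The two minor bounds are multiplied and regrouped crosswise; the claim is then the inequality
  -- of arithmetic and geometric means for A_ii B_jj and A_jj B_ii.
  have h1 : (‖A i j‖ * ‖B i j‖) ^ 2 ≤
      ((A i i).re * (B j j).re) * ((A j j).re * (B i i).re) := by
    calc (‖A i j‖ * ‖B i j‖) ^ 2 = ‖A i j‖ ^ 2 * ‖B i j‖ ^ 2 := by ring
      _ ≤ ((A i i).re * (A j j).re) * ((B i i).re * (B j j).re) := by gcongr
      _ = _ := by ring
  refine abs_le_of_sq_le_sq' ?_ (by positivity) |>.2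
  nlinarith [sq_nonneg ((A i i).re * (B j j).re - (A j j).re * (B i i).re)]

/-- The real part of `⟨A ⊗ B, 𝟙 + y ∑ⱼ |jj⟩⟨jj| + z ∑ⱼₖ |jj⟩⟨kk|⟩` is nonnegative when `y + z = -1`
and `|z| ≤ 1`. -/
theorem re_hsInner_lincomb_nonneg {y z : ℝ} (hyz : y + z = -1) (hz : |z| ≤ 1) {σ : Op 3}
    (hσ : σ ∈ separableStates 3) : 0 ≤ (hsInner σ (lincomb 1 y z)).re := by
  refine re_hsInner_nonneg_of_mem_separableStates (fun A B hA hB => ?_) hσ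
  have hd : ∀ {M : Matrix (Fin 3) (Fin 3) ℂ}, M.PosSemidef → ∀ k, (M k k).im = 0 := by
    intro M hM k
    exact (Complex.le_def.1 (hM.diag_nonneg (i := k))).2.symm
  -- Because 1 + y + z = 0, the terms A_ii B_ii cancel and the expectation is the real part of
  -- ∑_{i≠j} (A_ii B_jj + z A_ij B_ij). The bound |z| ≤ 1 lets the diagonal products dominate for
  -- each pair.
  have hoff : ∀ i j, -((A i i).re * (B j j).re + (A j j).re * (B i i).re) ≤
      2 * (z * (A i j * B i j).re) := by
    intro i j
    have h1 := norm_mul_norm_le_of_posSemidef hA.1 hB.1 i j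
    have h2 : |z * (A i j * B i j).re| ≤ ‖A i j‖ * ‖B i j‖ := by
      rw [abs_mul, ← norm_mul]
      calc |z| * |(A i j * B i j).re| ≤ 1 * ‖A i j * B i j‖ := by
            gcongr
            exact Complex.abs_re_le_norm _
        _ = _ := one_mul _
    have := (abs_le.1 h2).1
    linarith
  have h01 := hoff 0 1
  have h10 := hoff 1 0
  have h02 := hoff 0 2
  have h20 := hoff 2 0
  have h12 := hoff 1 2
  have h21 := hoff 2 1
  have hy : y = -1 - z := by linarith
  rw [hsInner_lincomb_right, Matrix.trace_kronecker]
  simp only [Matrix.trace, Matrix.diag, Fin.sum_univ_three, Matrix.kroneckerMap_apply,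
    Complex.add_re, Complex.star_def, Complex.conj_re, Complex.mul_re, Complex.add_im,
    Complex.ofReal_re, Complex.ofReal_im, zero_mul, hd hA.1, hd hB.1] at *
  subst hy
  linarith

theorem bell_posSemidef {d : ℕ} (n k : Fin d) : (bell n k).PosSemidef := by
  have h := (Matrix.posSemidef_vecMulVec_self_star (phiPlus d)).mul_mul_conjTranspose_same
    (weyl n k ⊗ₖ (1 : Matrix (Fin d) (Fin d) ℂ))
  rwa [Matrix.conjTranspose_kronecker, Matrix.conjTranspose_one] at h

/-- The three numbers are the eigenvalues: x on the |ij⟩ with i ≠ j, x + y on the part of the span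
of the |jj⟩ orthogonal to φ₊, and x + y + 3z on φ₊. Necessity tests an eigenvector of each;
sufficiency is the spectral decomposition. -/
theorem lincomb_posSemidef_iff (x y z : ℝ) :
    (lincomb x y z).PosSemidef ↔ 0 ≤ x ∧ 0 ≤ x + y ∧ 0 ≤ x + y + 3 * z := by
  constructor
  · intro h
    refine ⟨?_, ?_, ?_⟩
    · have h1 := h.diag_nonneg (i := ((0 : Fin 3), (1 : Fin 3)))
      rw [lincomb_apply] at h1
      simpa using h1
    · have h1 := h.dotProduct_mulVec_nonneg
        (fun p => if p = (0, 0) then 1 else if p = (1, 1) then -1 else 0)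
      simp [dotProduct, Matrix.mulVec, Fintype.sum_prod_type, Fin.sum_univ_three,
        lincomb_apply] at h1
      norm_cast at h1
      linarith
    · have h1 := h.dotProduct_mulVec_nonneg (fun p => if p.1 = p.2 then 1 else 0)
      simp [dotProduct, Matrix.mulVec, Fintype.sum_prod_type, Fin.sum_univ_three,
        lincomb_apply] at h1
      norm_cast at h1
      linarith
  · rintro ⟨h1, h2, h3⟩
    have hoff : (lincomb 1 (-1) 0).PosSemidef := by
      have : lincomb 1 (-1) 0 = Matrix.diagonal fun p => if p.1 = p.2 then 0 else 1 := by
        ext ⟨i, j⟩ ⟨k, l⟩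
        rw [lincomb_apply, Matrix.diagonal_apply]
        by_cases hij : i = j <;> simp [hij]
        split_ifs <;> norm_num
      rw [this]
      refine Matrix.PosSemidef.diagonal fun p => ?_
      dsimp only [Pi.zero_apply]
      split_ifs <;> simp
    have hsplit : lincomb x y z = x • lincomb 1 (-1) 0 +
        (x + y) • (bell (1 : Fin 3) 0 + bell (2 : Fin 3) 0) +
          (x + y + 3 * z) • bell (0 : Fin 3) 0 := by
      rw [bell_one_add_bell_two_eq, bell_zero_zero_eq]
      simp only [smul_lincomb, lincomb_add]
      congr 1 <;> ring
    rw [hsplit]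
    exact ((hoff.smul h1).add (((bell_posSemidef 1 0).add (bell_posSemidef 2 0)).smul h2)).add
      ((bell_posSemidef 0 0).smul h3)

theorem rho_isDensity_iff (α β : ℝ) :
    IsDensity (rho α β) ↔ α ≤ -β + 1 ∧ α ≤ 7 / 2 * β + 1 ∧ 1 / 8 * β - 1 / 8 ≤ α := by
  have htr : (lincomb ((1 - α - β) / 9) (β / 2) ((α - β / 2) / 3)).trace = 1 := by
    rw [trace_lincomb]
    norm_cast
    ring
  rw [IsDensity, rho_eq, lincomb_posSemidef_iff, and_iff_left htr]
  constructor
  · rintro ⟨h1, h2, h3⟩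
    refine ⟨?_, ?_, ?_⟩ <;> linarith
  · rintro ⟨h1, h2, h3⟩
    refine ⟨?_, ?_, ?_⟩ <;> linarith

/-! ### Separable decompositions -/

theorem isDensity_smul_vecMulVec {ι : Type*} [Fintype ι] (v : ι → ℂ) {r : ℝ} (hr : 0 ≤ r)
    (hv : r * (v ⬝ᵥ star v) = 1) : IsDensity (r • Matrix.vecMulVec v (star v)) := by
  refine ⟨(Matrix.posSemidef_vecMulVec_self_star v).smul hr, ?_⟩
  rw [Matrix.trace_smul, Matrix.trace_vecMulVec, Complex.real_smul, hv]

/-- A convex combination of products of (unnormalised) pure states is separable. -/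
theorem mem_separableStates_of_pure {d : ℕ} {κ : Type*} [Fintype κ] {σ : Op d} {r s : ℝ}
    (w : κ → ℝ) (u v : κ → Fin d → ℂ) (hr : 0 ≤ r) (hs : 0 ≤ s) (hw : ∀ a, 0 ≤ w a)
    (hw1 : ∑ a, w a = 1) (hu : ∀ a, r * (u a ⬝ᵥ star (u a)) = 1)
    (hv : ∀ a, s * (v a ⬝ᵥ star (v a)) = 1)
    (hσ : ∀ i j k l, σ (i, j) (k, l) =
      r * s * ∑ a, w a * (u a i * star (u a k) * (v a j * star (v a l)))) :
    σ ∈ separableStates d := by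
  have h : σ = ∑ a, w a • ((r • Matrix.vecMulVec (u a) (star (u a))) ⊗ₖ
      (s • Matrix.vecMulVec (v a) (star (v a)))) := by
    ext ⟨i, j⟩ ⟨k, l⟩
    rw [hσ, Matrix.sum_apply, Finset.mul_sum]
    refine Finset.sum_congr rfl fun a _ => ?_
    simp [Matrix.vecMulVec_apply]
    ring
  rw [h]
  exact convex_separableStates.sum_mem (fun a _ => hw a) hw1 fun a _ =>
    kronecker_mem_separableStates (isDensity_smul_vecMulVec _ hr (hu a))
      (isDensity_smul_vecMulVec _ hs (hv a))

theorem sum_cubeRoot_pow_mul (s : ℕ) :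
    ∑ a : Fin 3, cubeRoot ^ (a.val * s) = if 3 ∣ s then 3 else 0 := by
  have h1 : ∑ a : Fin 3, cubeRoot ^ (a.val * s) = ∑ a : Fin 3, (cubeRoot ^ s) ^ a.val := by
    simp only [← pow_mul, mul_comm]
  rw [h1]
  split_ifs with h
  · rw [(cubeRoot_isPrimitiveRoot.pow_eq_one_iff_dvd s).2 h]
    simp
  · have h0 : cubeRoot ^ s ≠ 1 := fun h' => h ((cubeRoot_isPrimitiveRoot.pow_eq_one_iff_dvd s).1 h')
    have h3 : (cubeRoot ^ s) ^ 3 = 1 := by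
      rw [← pow_mul, mul_comm, pow_mul, cubeRoot_pow_three, one_pow]
    have h4 : (cubeRoot ^ s - 1) * ((cubeRoot ^ s) ^ 2 + cubeRoot ^ s + 1) = 0 := by
      linear_combination h3
    have h5 := (mul_eq_zero.1 h4).resolve_left (sub_ne_zero.2 h0)
    simp only [Fin.sum_univ_three, Fin.val_zero, Fin.val_one, Fin.val_two]
    linear_combination h5

theorem star_cubeRoot_pow (n : ℕ) : star (cubeRoot ^ n) = cubeRoot ^ (2 * n) := by
  rw [star_pow, star_cubeRoot, pow_mul]

theorem cubeRoot_pow_mul_star (n : ℕ) : cubeRoot ^ n * star (cubeRoot ^ n) = 1 := by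
  rw [star_cubeRoot_pow, ← pow_add, show n + 2 * n = 3 * n by ring, pow_mul, cubeRoot_pow_three,
    one_pow]

theorem intCast_mul_cubeRoot_pow_mul_star (m : ℤ) (n : ℕ) :
    (m : ℂ) * cubeRoot ^ n * star ((m : ℂ) * cubeRoot ^ n) = m * m := by
  rw [star_mul', star_intCast, mul_mul_mul_comm, cubeRoot_pow_mul_star, mul_one]

theorem lincomb_diagonal_mem_separableStates : lincomb 0 (1 / 3) 0 ∈ separableStates 3 := by
  refine mem_separableStates_of_pure (κ := Fin 3) (r := 1) (s := 1) (fun _ => 1 / 3)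
    (fun a i => if i = a then 1 else 0) (fun a i => if i = a then 1 else 0)
    zero_le_one zero_le_one (fun _ => by norm_num) (by simp) (fun a => by simp [dotProduct])
    (fun a => by simp [dotProduct]) fun i j k l => ?_
  rw [lincomb_apply]
  simp
  grind

theorem lincomb_offDiagonal_mem_separableStates :
    lincomb (1 / 6) (-1 / 6) 0 ∈ separableStates 3 := by
  refine mem_separableStates_of_pure (κ := Fin 3 × Fin 3) (r := 1) (s := 1)
    (fun a => if a.1 = a.2 then 0 else 1 / 6)
    (fun a i => if i = a.1 then 1 else 0) (fun a i => if i = a.2 then 1 else 0)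
    zero_le_one zero_le_one (fun a => ?_) ?_ (fun a => by simp [dotProduct])
    (fun a => by simp [dotProduct]) fun i j k l => ?_
  · split_ifs <;> norm_num
  · simp [Fintype.sum_prod_type, Fin.sum_univ_three]
    norm_num
  · rw [lincomb_apply]
    simp [Fintype.sum_prod_type, apply_ite (Complex.ofReal : ℝ → ℂ)]
    grind

/-- The average of `φ ⊗ φ̄` over the vectors `φ` with entries `1, ω^a, ω^b`. -/
theorem lincomb_phases_mem_separableStates :
    lincomb (1 / 9) (-1 / 9) (1 / 9) ∈ separableStates 3 := by
  let f : Fin 3 → ℕ := ![0, 1, 0]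
  let g : Fin 3 → ℕ := ![0, 0, 1]
  have hstar (a : Fin 3 × Fin 3) (i : Fin 3) :
      star (cubeRoot ^ (2 * (a.1.val * f i + a.2.val * g i))) =
        cubeRoot ^ (a.1.val * f i + a.2.val * g i) := by
    rw [← star_cubeRoot_pow, star_star]
  refine mem_separableStates_of_pure (κ := Fin 3 × Fin 3) (r := 1 / 3) (s := 1 / 3)
    (fun _ => 1 / 9)
    (fun a i => cubeRoot ^ (a.1.val * f i + a.2.val * g i))
    (fun a i => cubeRoot ^ (2 * (a.1.val * f i + a.2.val * g i)))
    (by norm_num) (by norm_num) (fun _ => by norm_num) (by simp) (fun a => ?_)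
    (fun a => ?_) fun i j k l => ?_
  · simp only [dotProduct, Pi.star_apply, cubeRoot_pow_mul_star]
    simp
  · simp only [dotProduct, Pi.star_apply, cubeRoot_pow_mul_star]
    simp
  · have hsum : ∑ a : Fin 3 × Fin 3, cubeRoot ^ (a.1.val * f i + a.2.val * g i) *
          star (cubeRoot ^ (a.1.val * f k + a.2.val * g k)) *
          (cubeRoot ^ (2 * (a.1.val * f j + a.2.val * g j)) *
            star (cubeRoot ^ (2 * (a.1.val * f l + a.2.val * g l)))) =
        (if 3 ∣ f i + 2 * f k + 2 * f j + f l then 3 else 0) *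
          (if 3 ∣ g i + 2 * g k + 2 * g j + g l then 3 else 0) := by
      rw [← sum_cubeRoot_pow_mul, ← sum_cubeRoot_pow_mul, Finset.sum_mul_sum,
        Fintype.sum_prod_type]
      refine Finset.sum_congr rfl fun a _ => Finset.sum_congr rfl fun b _ => ?_
      rw [hstar (a, b), star_cubeRoot_pow, ← pow_add, ← pow_add, ← pow_add, ← pow_add]
      congr 1
      ring
    -- Each exponent is congruent modulo 3 to fᵢ + f_l - f_j - f_k, which lies between -2 and 2, so
    -- divisibility by 3 forces it to vanish. Hence cube roots already average like the full phase
    -- group, and the entries reduce to a finite integer check.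
    have hcomb : ∀ i j k l : Fin 3,
        (if 3 ∣ f i + 2 * f k + 2 * f j + f l then (3 : ℤ) else 0) *
          (if 3 ∣ g i + 2 * g k + 2 * g j + g l then 3 else 0) =
        (if i = k ∧ j = l then 9 else 0) + (if i = j ∧ i = k ∧ j = l then -9 else 0) +
          (if i = j ∧ k = l then 9 else 0) := by decide
    have hC := congrArg (Int.cast : ℤ → ℂ) (hcomb i j k l)
    push_cast at hC
    rw [← Finset.mul_sum, hsum, hC, lincomb_apply]
    push_cast
    split_ifs <;> norm_num

/-- The average of `(e_{r+1} + z e_{r+2}) ⊗ (e_{r+1} - z̄ e_{r+2})` over `r` and the cube roots of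
unity `z`. -/
theorem lincomb_signedPairs_mem_separableStates :
    lincomb (1 / 12) (1 / 6) (-1 / 12) ∈ separableStates 3 := by
  let f : Fin 3 → Fin 3 → ℕ := fun r i => if i = r + 2 then 1 else 0
  let c : Fin 3 → Fin 3 → ℤ := fun r i => if i = r then 0 else 1
  let s : Fin 3 → Fin 3 → ℤ := fun r i => if i = r then 0 else if i = r + 2 then -1 else 1
  have hc : ∀ r, ∑ i, c r i * c r i = 2 := by decide
  have hs : ∀ r, ∑ i, s r i * s r i = 2 := by decide
  have hstar (n : ℕ) : star (cubeRoot ^ (2 * n)) = cubeRoot ^ n := by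
    rw [← star_cubeRoot_pow, star_star]
  refine mem_separableStates_of_pure (κ := Fin 3 × Fin 3) (r := 1 / 2) (s := 1 / 2)
    (fun _ => 1 / 9)
    (fun a i => (c a.1 i : ℂ) * cubeRoot ^ (a.2.val * f a.1 i))
    (fun a i => (s a.1 i : ℂ) * cubeRoot ^ (2 * (a.2.val * f a.1 i)))
    (by norm_num) (by norm_num) (fun _ => by norm_num) (by simp) (fun a => ?_)
    (fun a => ?_) fun i j k l => ?_
  · have h : ∑ i, (c a.1 i : ℂ) * c a.1 i = 2 := by exact_mod_cast hc a.1
    simp only [dotProduct, Pi.star_apply, intCast_mul_cubeRoot_pow_mul_star, h]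
    norm_num
  · have h : ∑ i, (s a.1 i : ℂ) * s a.1 i = 2 := by exact_mod_cast hs a.1
    simp only [dotProduct, Pi.star_apply, intCast_mul_cubeRoot_pow_mul_star, h]
    norm_num
  · have hsum : ∑ a : Fin 3 × Fin 3, (c a.1 i : ℂ) * cubeRoot ^ (a.2.val * f a.1 i) *
          star ((c a.1 k : ℂ) * cubeRoot ^ (a.2.val * f a.1 k)) *
          ((s a.1 j : ℂ) * cubeRoot ^ (2 * (a.2.val * f a.1 j)) *
            star ((s a.1 l : ℂ) * cubeRoot ^ (2 * (a.2.val * f a.1 l)))) =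
        ∑ r, (c r i : ℂ) * c r k * s r j * s r l *
          (if 3 ∣ f r i + 2 * f r k + 2 * f r j + f r l then 3 else 0) := by
      rw [Fintype.sum_prod_type]
      refine Finset.sum_congr rfl fun r _ => ?_
      rw [← sum_cubeRoot_pow_mul, Finset.mul_sum]
      refine Finset.sum_congr rfl fun a _ => ?_
      rw [star_mul', star_mul', hstar, star_cubeRoot_pow, star_intCast, star_intCast]
      ring
    -- Here r is the omitted basis index. Each |ij⟩⟨ij| with i ≠ j and each |jj⟩⟨kk| with j ≠ k
    -- occurs for exactly one r, the latter with sign -1, while |jj⟩⟨jj| occurs for two. So the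
    -- totals are 3, -3 and 6 = 3 + 6 - 3.
    have hcomb : ∀ i j k l : Fin 3,
        ∑ r, c r i * c r k * s r j * s r l *
          (if 3 ∣ f r i + 2 * f r k + 2 * f r j + f r l then 3 else 0) =
        (if i = k ∧ j = l then 3 else 0) + (if i = j ∧ i = k ∧ j = l then 6 else 0) +
          (if i = j ∧ k = l then -3 else 0) := by decide
    have hC := congrArg (Int.cast : ℤ → ℂ) (hcomb i j k l)
    push_cast at hC
    rw [← Finset.mul_sum, hsum, hC, lincomb_apply]
    push_cast
    split_ifs <;> norm_num

/-- The trapezoid of separable parameters. -/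
theorem rho_mem_separableStates {α β : ℝ} (h1 : α ≤ 7 / 2 * β + 1) (h2 : 1 / 8 * β - 1 / 8 ≤ α)
    (h3 : α ≤ β / 8 + 1 / 4) (h4 : 5 / 4 * β - 1 / 2 ≤ α) : rho α β ∈ separableStates 3 := by
  -- The horizontal coordinate is β. The parallel sides are α = β/8 - 1/8 and α = β/8 + 1/4, at
  -- vertical distance 3/8, and s is the relative height between them. At height s the slice starts
  -- at β = -1/3 + s/9 and has β-width 2/3 + 2s/9; t is the relative position in it.
  obtain ⟨s, hs⟩ : ∃ s, s = (α - β / 8 + 1 / 8) / (3 / 8) := ⟨_, rfl⟩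
  have hα : α = β / 8 - 1 / 8 + 3 / 8 * s := by rw [hs]; ring
  have hs0 : 0 ≤ s := by linarith
  have hs1 : s ≤ 1 := by linarith
  have hpos : 0 < 2 / 3 + 2 / 9 * s := by linarith
  obtain ⟨t, ht⟩ : ∃ t, t = (β + 1 / 3 - s / 9) / (2 / 3 + 2 / 9 * s) := ⟨_, rfl⟩
  have hβ : β = -1 / 3 + s / 9 + t * (2 / 3 + 2 / 9 * s) := by
    rw [ht, div_mul_cancel₀ _ hpos.ne']; ring
  have ht0 : 0 ≤ t := by rw [ht]; exact div_nonneg (by linarith) hpos.le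
  have ht1 : t ≤ 1 := by rw [ht, div_le_one hpos]; linarith
  -- The left side joins the corners (α, β) = (-1/6, -1/3) and (2/9, -2/9), the right side (-1/12,
  -- 1/3) and (1/3, 2/3).
  have hL := convex_separableStates lincomb_offDiagonal_mem_separableStates
    lincomb_phases_mem_separableStates (sub_nonneg.2 hs1) hs0 (sub_add_cancel 1 s)
  have hR := convex_separableStates lincomb_signedPairs_mem_separableStates
    lincomb_diagonal_mem_separableStates (sub_nonneg.2 hs1) hs0 (sub_add_cancel 1 s)
  have h := convex_separableStates hL hR (sub_nonneg.2 ht1) ht0 (sub_add_cancel 1 t)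
  convert h using 1
  rw [rho_eq]
  simp only [smul_lincomb, lincomb_add]
  rw [hα]
  congr 1 <;> rw [hβ] <;> ring

/-! ### Nearest separable states and optimal witnesses -/

theorem hsNorm_lincomb (x y z : ℝ) : hsNorm (lincomb x y z) =
    √(x * (9 * x + 3 * y + 3 * z) + y * (3 * x + 3 * y + 3 * z) + z * (3 * x + 3 * y + 9 * z)) := by
  rw [hsNorm, hsInner_lincomb_lincomb, Complex.ofReal_re]

theorem witnessOp_lincomb {N x y z x' y' z' : ℝ}
    (hN : hsNorm (lincomb x y z - lincomb x' y' z') = N) :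
    witnessOp (lincomb x y z) (lincomb x' y' z') =
      N⁻¹ • lincomb (x - x' - ((x - x') * (9 * x + 3 * y + 3 * z) +
        (y - y') * (3 * x + 3 * y + 3 * z) + (z - z') * (3 * x + 3 * y + 9 * z)))
        (y - y') (z - z') := by
  rw [witnessOp, hN, lincomb_sub, hsInner_lincomb_lincomb, ← Complex.ofReal_inv, Complex.coe_smul,
    Complex.coe_smul, one_eq_lincomb, smul_lincomb, lincomb_sub]
  congr 2 <;> ring

theorem sqrt_two_inv : (6 * √2)⁻¹ = √2 / 12 := by
  have h : √2 * √2 = 2 := Real.mul_self_sqrt (by norm_num)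
  rw [inv_eq_iff_eq_inv, inv_div, eq_div_iff (by positivity)]
  linear_combination 6 * h

/-- A separable `ρ₀` for which `witnessOp ρ₀ ρ` is a nonnegative multiple of an operator that is
nonnegative on separable states is nearest to `ρ`, and `witnessOp ρ₀ ρ` detects `ρ`. -/
theorem isNearestSeparable_and_isWitness {ρ ρ₀ : Op 3} {k N y z : ℝ} (h₀ : ρ₀ ∈ separableStates 3)
    (hN : hsNorm (ρ₀ - ρ) = N) (hN0 : 0 < N) (hk : 0 ≤ k) (hyz : y + z = -1) (hz : |z| ≤ 1)
    (hW : witnessOp ρ₀ ρ = k • lincomb 1 y z)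
    (hρ : hsInner ρ (k • lincomb 1 y z) = ((-N : ℝ) : ℂ)) :
    IsNearestSeparable ρ ρ₀ ∧ IsWitness (witnessOp ρ₀ ρ) ρ := by
  have hpos : ∀ σ ∈ separableStates 3, 0 ≤ (hsInner σ (witnessOp ρ₀ ρ)).re := fun σ hσ => by
    rw [hW, hsInner_real_smul_right, Complex.re_ofReal_mul]
    exact mul_nonneg hk (re_hsInner_lincomb_nonneg hyz hz hσ)
  refine ⟨isNearestSeparable_of_witnessOp_nonneg h₀ (hN ▸ hN0) hpos, ?_, ?_, hpos⟩
  · rw [hW, smul_lincomb]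
    exact lincomb_isHermitian _ _ _
  · rw [hW, hρ, Complex.ofReal_re]
    linarith

/-- Changing α at fixed β is Hilbert–Schmidt orthogonal to the edge α = β/8 + 1/4, so the foot keeps
β. -/
theorem regionI_nearest {α β : ℝ} (h : RegionI α β) :
    IsNearestSeparable (rho α β) (rho (1 / 4 + 1 / 8 * β) β) ∧
    hsNorm (rho (1 / 4 + 1 / 8 * β) β - rho α β) = 2 * √2 / 3 * (α - 1 / 4 - 1 / 8 * β) ∧
    witnessOp (rho (1 / 4 + 1 / 8 * β) β) (rho α β) =
      (1 / (6 * √2)) • ((2 : ℝ) • (1 : Op 3) - opU) ∧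
    IsWitness (witnessOp (rho (1 / 4 + 1 / 8 * β) β) (rho α β)) (rho α β) ∧
    hsInner (rho α β) (witnessOp (rho (1 / 4 + 1 / 8 * β) β) (rho α β)) =
      ((-(2 * √2 / 3 * (α - 1 / 4 - 1 / 8 * β)) : ℝ) : ℂ) := by
  obtain ⟨h1, h2, h3⟩ := h
  have h2s : √2 * √2 = 2 := Real.mul_self_sqrt (by norm_num)
  have ht : 0 < α - 1 / 4 - 1 / 8 * β := by linarith
  have hN0 : 0 < 2 * √2 / 3 * (α - 1 / 4 - 1 / 8 * β) := by positivity
  -- The inequalities of Region I force -2/9 < β < 2/3, so the foot lies between the two corners of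
  -- the top edge.
  have h₀ : rho (1 / 4 + 1 / 8 * β) β ∈ separableStates 3 :=
    rho_mem_separableStates (by linarith) (by linarith) (by linarith) (by linarith)
  have hN : hsNorm (rho (1 / 4 + 1 / 8 * β) β - rho α β) =
      2 * √2 / 3 * (α - 1 / 4 - 1 / 8 * β) := by
    rw [rho_eq, rho_eq, lincomb_sub, hsNorm_lincomb, Real.sqrt_eq_iff_mul_self_eq_of_pos hN0]
    linear_combination (4 / 9 * (α - 1 / 4 - 1 / 8 * β) ^ 2) * h2s
  have hW : witnessOp (rho (1 / 4 + 1 / 8 * β) β) (rho α β) = (√2 / 4) • lincomb 1 0 (-1) := by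
    have hinv : (2 * √2 / 3 * (α - 1 / 4 - 1 / 8 * β))⁻¹ * (α - 1 / 4 - 1 / 8 * β) =
        3 / 4 * √2 := by
      rw [inv_mul_eq_div, div_eq_iff hN0.ne']
      linear_combination (-(α - 1 / 4 - 1 / 8 * β) / 2) * h2s
    simp only [rho_eq] at hN ⊢
    rw [witnessOp_lincomb hN, smul_lincomb, smul_lincomb]
    congr 1
    · linear_combination (1 / 3) * hinv
    · ring
    · linear_combination (-1 / 3) * hinv
  have hρ : hsInner (rho α β) ((√2 / 4) • lincomb 1 0 (-1)) =
      ((-(2 * √2 / 3 * (α - 1 / 4 - 1 / 8 * β)) : ℝ) : ℂ) := by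
    rw [rho_eq, smul_lincomb, hsInner_lincomb_lincomb]
    congr 1
    ring
  obtain ⟨hnear, hwit⟩ := isNearestSeparable_and_isWitness h₀ hN hN0 (by positivity)
    (by norm_num) (by norm_num) hW hρ
  refine ⟨hnear, hN, ?_, hwit, hW ▸ hρ⟩
  rw [hW, opU_eq, one_eq_lincomb, one_div, sqrt_two_inv]
  simp only [smul_lincomb, lincomb_sub]
  congr 1 <;> ring

/-- The parameters of ρ₀ are the foot of the perpendicular to the edge α = 5β/4 - 1/2; the
orthogonal direction is (1, -4) in (α, β). -/
theorem regionII_nearest {α β : ℝ} (h : RegionII α β) {ρ₀ : Op 3}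
    (hρ₀ : ρ₀ = rho (1 / 24 * (-2 + 20 * α + 5 * β)) (1 / 6 * (2 + 4 * α + β))) :
    IsNearestSeparable (rho α β) ρ₀ ∧
    hsNorm (ρ₀ - rho α β) = 1 / (6 * √2) * (-4 * α - 2 + 5 * β) ∧
    witnessOp ρ₀ (rho α β) = (1 / (6 * √2)) • ((2 : ℝ) • (1 : Op 3) + opU₁ - opU₂) ∧
    IsWitness (witnessOp ρ₀ (rho α β)) (rho α β) ∧
    hsInner (rho α β) (witnessOp ρ₀ (rho α β)) =
      ((1 / (6 * √2) * (4 * α + 2 - 5 * β) : ℝ) : ℂ) := by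
  obtain ⟨h1, h2, h3⟩ := h
  subst hρ₀
  have h2s : √2 * √2 = 2 := Real.mul_self_sqrt (by norm_num)
  rw [one_div (6 * √2), sqrt_two_inv]
  have ht : 0 < -4 * α - 2 + 5 * β := by linarith
  have hN0 : 0 < √2 / 12 * (-4 * α - 2 + 5 * β) := by positivity
  -- Region II gives 0 < 4α + β < 2, which places the new second parameter between 1/3 and 2/3, the
  -- ends of the right edge.
  have h₀ : rho (1 / 24 * (-2 + 20 * α + 5 * β)) (1 / 6 * (2 + 4 * α + β)) ∈ separableStates 3 :=
    rho_mem_separableStates (by linarith) (by linarith) (by linarith) (by linarith)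
  have hN : hsNorm (rho (1 / 24 * (-2 + 20 * α + 5 * β)) (1 / 6 * (2 + 4 * α + β)) - rho α β) =
      √2 / 12 * (-4 * α - 2 + 5 * β) := by
    rw [rho_eq, rho_eq, lincomb_sub, hsNorm_lincomb, Real.sqrt_eq_iff_mul_self_eq_of_pos hN0]
    linear_combination (1 / 144 * (-4 * α - 2 + 5 * β) ^ 2) * h2s
  have hW : witnessOp (rho (1 / 24 * (-2 + 20 * α + 5 * β)) (1 / 6 * (2 + 4 * α + β))) (rho α β) =
      (√2 / 4) • lincomb 1 (-2) 1 := by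
    have hinv : (√2 / 12 * (-4 * α - 2 + 5 * β))⁻¹ * (-4 * α - 2 + 5 * β) = 6 * √2 := by
      rw [inv_mul_eq_div, div_eq_iff hN0.ne']
      linear_combination (-(-4 * α - 2 + 5 * β) / 2) * h2s
    simp only [rho_eq] at hN ⊢
    rw [witnessOp_lincomb hN, smul_lincomb, smul_lincomb]
    congr 1
    · linear_combination (1 / 24) * hinv
    · linear_combination (-1 / 12) * hinv
    · linear_combination (1 / 24) * hinv
  have hρ : hsInner (rho α β) ((√2 / 4) • lincomb 1 (-2) 1) =
      ((-(√2 / 12 * (-4 * α - 2 + 5 * β)) : ℝ) : ℂ) := by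
    rw [rho_eq, smul_lincomb, hsInner_lincomb_lincomb]
    congr 1
    ring
  obtain ⟨hnear, hwit⟩ := isNearestSeparable_and_isWitness h₀ hN hN0 (by positivity)
    (by norm_num) (by norm_num) hW hρ
  refine ⟨hnear, hN, ?_, hwit, ?_⟩
  · rw [hW, opU₁_eq, opU₂_eq, one_eq_lincomb]
    simp only [smul_lincomb, lincomb_add, lincomb_sub]
    congr 1 <;> ring
  · rw [hW, hρ]
    congr 1
    ring

theorem IsWitness.notMem_separableStates {d : ℕ} {A ρ : Op d} (h : IsWitness A ρ) :
    ρ ∉ separableStates d := fun hρ => (h.2.2 ρ hρ).not_gt h.2.1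

/-- Each region lists only the positivity constraints that bind there; the third follows from the
others. A state outside both regions satisfies all four trapezoid inequalities, and inside a region
the witness rules out separability. -/
theorem rho_isEntangled_iff (α β : ℝ) :
    IsEntangled (rho α β) ↔ RegionI α β ∨ RegionII α β := by
  rw [IsEntangled, rho_isDensity_iff]
  constructor
  · rintro ⟨⟨h1, h2, h3⟩, hS⟩
    by_contra hR
    rw [not_or, RegionI, RegionII] at hR
    obtain ⟨hI, hII⟩ := hR
    refine hS (rho_mem_separableStates h2 h3 ?_ ?_)
    · by_contra hlt
      exact hI ⟨h2, h1, not_le.1 hlt⟩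
    · by_contra hlt
      exact hII ⟨not_le.1 hlt, h3, h1⟩
  · rintro (h | h)
    · have hwit := (regionI_nearest h).2.2.2.1
      obtain ⟨h1, h2, h3⟩ := h
      exact ⟨⟨h2, h1, by linarith⟩, hwit.notMem_separableStates⟩
    · have hwit := (regionII_nearest h rfl).2.2.2.1
      obtain ⟨h1, h2, h3⟩ := h
      exact ⟨⟨h3, by linarith, h2⟩, hwit.notMem_separableStates⟩

end TwoQudit

open TwoQudit in
theorem mainTheorem3 :
    -- the Bloch form of the two-parameter operators, and which of them are entangled states
    (∀ α β : ℝ, rho α β = bloch (α - β / 2) (α + β)) ∧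
    (∀ α β : ℝ, IsEntangled (rho α β) ↔ RegionI α β ∨ RegionII α β) ∧
    -- Region I
    (∀ α β : ℝ, RegionI α β →
      ∃ ρ₀ : Op 3,
        ρ₀ = rho (1 / 4 + 1 / 8 * β) β ∧
        ρ₀ = bloch (1 / 4 - 3 / 8 * β) (1 / 4 + 9 / 8 * β) ∧
        IsNearestSeparable (rho α β) ρ₀ ∧
        hsMeasure (rho α β) = hsNorm (ρ₀ - rho α β) ∧
        hsMeasure (rho α β) = 2 * √2 / 3 * (α - 1 / 4 - 1 / 8 * β) ∧
        witnessOp ρ₀ (rho α β) = (1 / (6 * √2)) • ((2 : ℝ) • (1 : Op 3) - opU) ∧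
        IsWitness (witnessOp ρ₀ (rho α β)) (rho α β) ∧
        hsInner (rho α β) (witnessOp ρ₀ (rho α β)) =
          ((-(2 * √2 / 3 * (α - 1 / 4 - 1 / 8 * β)) : ℝ) : ℂ)) ∧
    -- Region II
    (∀ α β : ℝ, RegionII α β →
      ∃ ρ₀ : Op 3,
        ρ₀ = rho (1 / 24 * (-2 + 20 * α + 5 * β)) (1 / 6 * (2 + 4 * α + β)) ∧
        IsNearestSeparable (rho α β) ρ₀ ∧
        hsMeasure (rho α β) = hsNorm (ρ₀ - rho α β) ∧
        hsMeasure (rho α β) = 1 / (6 * √2) * (-4 * α - 2 + 5 * β) ∧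
        witnessOp ρ₀ (rho α β) = (1 / (6 * √2)) • ((2 : ℝ) • (1 : Op 3) + opU₁ - opU₂) ∧
        IsWitness (witnessOp ρ₀ (rho α β)) (rho α β) ∧
        hsInner (rho α β) (witnessOp ρ₀ (rho α β)) =
          ((1 / (6 * √2) * (4 * α + 2 - 5 * β) : ℝ) : ℂ)) := by
  refine ⟨fun α β => ?_, rho_isEntangled_iff, fun α β h => ?_, fun α β h => ?_⟩
  · rw [rho_eq, bloch_eq]
    congr 1 <;> ring
  · obtain ⟨hnear, hN, hW, hwit, hρ⟩ := regionI_nearest h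
    refine ⟨_, rfl, ?_, hnear, hnear.hsMeasure_eq, hnear.hsMeasure_eq.trans hN, hW, hwit, hρ⟩
    rw [rho_eq, bloch_eq]
    congr 1 <;> ring
  · obtain ⟨hnear, hN, hW, hwit, hρ⟩ := regionII_nearest h rfl
    exact ⟨_, rfl, hnear, hnear.hsMeasure_eq, hnear.hsMeasure_eq.trans hN, hW, hwit, hρ⟩
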